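/- All Hilbert spaces are finite-dimensional and $\log$ is to base $2$. Let $A=A_1A_2=A_1\otimes A_2$ with fixed standard orthonormal bases $\{|a_1\rangle\}$, $\{|a_2\rangle\}$, let $n=\log|A|$, and let $\mathcal T(X)=\sum_{a_1,a_2}\langle a_1a_2|X|a_1a_2\rangle\,|a_1\rangle\langle a_1|$ be the map from operators on $A$ to operators on $A_1$ that measures in the standard basis and discards $A_2$. A finite family of unitaries $U_1,\dots,U_L$ on $A$ is an (exact) unitary 2-design if for all operators $M$ on $A\otimes A$ $$\frac1L\sum_{i=1}^L U_i^{\otimes 2}M(U_i^\dagger)^{\otimes 2}=\int U^{\otimes 2}M(U^\dagger)^{\otimes 2}\,dU ,$$ where $dU$ is the Haar probability measure on the unitary group of $A$. For a normalized state $\rho_{AE}$ let $$H_{\min}(A|E)_\rho=\max_{\sigma_E}\max\{\lambda\in\mathbb R: 2^{-\lambda}\,\mathbb I_A\otimes\sigma_E\ge\rho_{AE}\},$$ the outer maximum being over normalized states $\sigma_E$ on $E$. Let $U_1,\dots,U_L$ be a unitary 2-design on $A$, let $k\in[-n,n]$ and $\varepsilon>0$, and suppose that $$\log|A_1|\le\min\bigl(n,\;n+k-2\log(1/\varepsilon)\bigr)$$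 (in particular this covers output size $\log|A_1|$ equal to this minimum). Then $\{U_1,\dots,U_L\}$ is a $(k,\varepsilon)$-QC-extractor with output size $\log|A_1|$: for every system $E$ and every normalized state $\rho_{AE}$ with $H_{\min}(A|E)_\rho\ge k$, $$\frac1L\sum_{i=1}^L\Bigl\|\mathcal T\bigl(U_i\rho_{AE}U_i^\dagger\bigr)-\frac{\mathbb I_{A_1}}{|A_1|}\otimes\rho_E\Bigr\|_1\le\varepsilon ,$$ where $U_i$ and $\mathcal T$ act on $A$ only, $\rho_E=\mathrm{tr}_A\,\rho_{AE}$, and $\|X\|_1=\mathrm{tr}\sqrt{X^\dagger X}$. -/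

import Mathlib

open scoped Kronecker MatrixOrder ComplexOrder

namespace QCExtractor

noncomputable section

/-! Finite-dimensional Hilbert spaces are represented as `ℂ^A` for a finite index type `A`, which
labels the standard (computational) basis.  Operators are complex matrices; the tensor product
of the spaces with labels `A` and `B` has labels `A × B`. -/

section Haar

variable (A : Type*) [Fintype A] [DecidableEq A]

instance unitaryGroup_compactSpace : CompactSpace (Matrix.unitaryGroup A ℂ) := by
  have hc : IsClosed ((Matrix.unitaryGroup A ℂ : Submonoid (Matrix A A ℂ)) :
      Set (Matrix A A ℂ)) := by
    have h : ((Matrix.unitaryGroup A ℂ : Submonoid (Matrix A A ℂ)) : Set (Matrix A A ℂ))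
        = {U : Matrix A A ℂ | U * star U = 1} := by
      ext U
      simp [Matrix.mem_unitaryGroup_iff]
    rw [h]
    exact isClosed_eq (by fun_prop) continuous_const
  have hk : IsCompact (Set.pi Set.univ fun _ : A => Set.pi Set.univ fun _ : A =>
      Metric.closedBall (0 : ℂ) 1) :=
    isCompact_univ_pi fun _ => isCompact_univ_pi fun _ => isCompact_closedBall _ _
  refine isCompact_iff_compactSpace.mp (hk.of_isClosed_subset hc ?_)
  intro U hU i _ j _
  simpa using entry_norm_bound_of_unitary hU i j

instance unitaryGroup_measurableSpace : MeasurableSpace (Matrix.unitaryGroup A ℂ) := borel _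

instance unitaryGroup_borelSpace : BorelSpace (Matrix.unitaryGroup A ℂ) := ⟨rfl⟩

/-- The Haar probability measure on the unitary group of the space `A`. -/
def haarUnitary : MeasureTheory.Measure (Matrix.unitaryGroup A ℂ) :=
  MeasureTheory.Measure.haarMeasure ⊤

end Haar

section Operators

variable {A B E : Type*} [Fintype A] [DecidableEq A] [Fintype B] [DecidableEq B]
  [Fintype E] [DecidableEq E]

/-- Normalized quantum states (density operators). -/
def IsState (ρ : Matrix A A ℂ) : Prop := ρ.PosSemidef ∧ ρ.trace = 1

/-- The trace norm `‖X‖₁ = tr √(X† X)`. -/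
def traceNorm (X : Matrix A A ℂ) : ℝ := (CFC.sqrt (X.conjTranspose * X)).trace.re

/-- The reduced operator `ρ_E = tr_A ρ_{AE}`. -/
def reduced (ρ : Matrix (A × E) (A × E) ℂ) : Matrix E E ℂ :=
  Matrix.of fun e e' => ∑ a, ρ (a, e) (a, e')

/-- The application `(Φ ⊗ id_E)(ρ)` of a map `Φ` to the system `A` of an operator `ρ` on `AE`:
`Φ` acts on each of the blocks `⟨e| ρ |e'⟩`. -/
def applyLeft (Φ : Matrix A A ℂ → Matrix B B ℂ) (ρ : Matrix (A × E) (A × E) ℂ) :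
    Matrix (B × E) (B × E) ℂ :=
  Matrix.of fun x y => Φ (Matrix.of fun a a' => ρ (a, x.2) (a', y.2)) x.1 y.1

/-- The conjugation `U_A ρ_{AE} U_A† = (U ⊗ 1) ρ (U ⊗ 1)†`. -/
def conjLeft (U : Matrix A A ℂ) (ρ : Matrix (A × E) (A × E) ℂ) : Matrix (A × E) (A × E) ℂ :=
  (U ⊗ₖ (1 : Matrix E E ℂ)) * ρ * (U ⊗ₖ (1 : Matrix E E ℂ)).conjTranspose

/-- `H_min(A|E)_{ρ|σ}`, the supremum of the real `l` with `2^{-l} 1_A ⊗ σ_E ≥ ρ_{AE}`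
(it is `-∞` if there is no such `l`). -/
def condMinEntropyRel (ρ : Matrix (A × E) (A × E) ℂ) (σ : Matrix E E ℂ) : EReal :=
  sSup ((fun l : ℝ => (l : EReal)) ''
    {l : ℝ | ρ ≤ (((2 : ℝ) ^ (-l) : ℝ) : ℂ) • ((1 : Matrix A A ℂ) ⊗ₖ σ)})

/-- The conditional min-entropy `H_min(A|E)_ρ`, the supremum of `H_min(A|E)_{ρ|σ}` over all
states `σ` on `E`. -/
def condMinEntropy (ρ : Matrix (A × E) (A × E) ℂ) : EReal :=
  sSup (condMinEntropyRel ρ '' {σ : Matrix E E ℂ | IsState σ})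

/-- A finite family of unitaries on `A` is an (exact) unitary 2-design if for all operators `M` on
`A ⊗ A`, the average of `U^{⊗2} M (U†)^{⊗2}` over the family is its Haar average
(the matrix-valued integral is taken entry by entry). -/
def IsTwoDesign {L : ℕ} (U : Fin L → Matrix.unitaryGroup A ℂ) : Prop :=
  ∀ (M : Matrix (A × A) (A × A) ℂ) (x y : A × A),
    ((1 / (L : ℂ)) • ∑ i, ((U i : Matrix A A ℂ) ⊗ₖ (U i : Matrix A A ℂ)) * M *
        ((U i : Matrix A A ℂ).conjTranspose ⊗ₖ (U i : Matrix A A ℂ).conjTranspose)) x y =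
      ∫ V : Matrix.unitaryGroup A ℂ, (((V : Matrix A A ℂ) ⊗ₖ (V : Matrix A A ℂ)) * M *
        ((V : Matrix A A ℂ).conjTranspose ⊗ₖ (V : Matrix A A ℂ).conjTranspose)) x y
        ∂(haarUnitary A)

end Operators

section Extractors

variable {A₁ A₂ : Type*} [Fintype A₁] [DecidableEq A₁] [Fintype A₂] [DecidableEq A₂]

/-- The measurement map `T(X) = ∑_{a₁ a₂} ⟨a₁ a₂| X |a₁ a₂⟩ |a₁⟩⟨a₁|` from operators on
`A = A₁ A₂` to operators on `A₁`. -/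
def measurementMap (X : Matrix (A₁ × A₂) (A₁ × A₂) ℂ) : Matrix A₁ A₁ ℂ :=
  ∑ a₁ : A₁, ∑ a₂ : A₂, X (a₁, a₂) (a₁, a₂) • Matrix.single a₁ a₁ (1 : ℂ)

/-- A finite family of unitaries on `A = A₁ A₂` is a `(k, ε)`-QC-extractor if for every
finite-dimensional system `E` and every state `ρ` on `AE` with `H_min(A|E)_ρ ≥ k`, the average
over the family of `‖T(U_i ρ U_i†) - 1_{A₁}/|A₁| ⊗ ρ_E‖₁` is at most `ε`. -/
def IsQCExtractor (k ε : ℝ) {L : ℕ} (U : Fin L → Matrix.unitaryGroup (A₁ × A₂) ℂ) : Prop :=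
  ∀ (E : Type) [Fintype E] [DecidableEq E]
    (ρ : Matrix ((A₁ × A₂) × E) ((A₁ × A₂) × E) ℂ),
    IsState ρ → (k : EReal) ≤ condMinEntropy ρ →
      (1 / (L : ℝ)) * ∑ i, traceNorm
        (applyLeft measurementMap (conjLeft (U i : Matrix (A₁ × A₂) (A₁ × A₂) ℂ) ρ) -
          (((Fintype.card A₁ : ℂ)⁻¹) • (1 : Matrix A₁ A₁ ℂ)) ⊗ₖ reduced ρ) ≤ ε

end Extractors

end

end QCExtractor

/-! Let `D_i` be the deviation produced by `U_i`, `p = |A₁|` and `d = |A|`. Cauchy–Schwarz with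
weight `1 ⊗ σ` (`traceNorm_sq_le`) replaces the trace norm by a second moment: `‖D_i‖₁² ≤ p · tr σ ·
tr (D_i (1 ⊗ σ⁻¹) D_i)`. The right side depends on `U_i` only through `U_i ⊗ U_i` and its adjoint,
so a 2-design averages it exactly.

The averaged operator commutes with every `W ⊗ W`, so the entries needed are those of a combination
of identity and swap. Solving for its two coefficients gives the mean `(α - 1/p) tr (ρ_E σ⁻¹ ρ_E) +
β tr (ρ (1 ⊗ σ⁻¹) ρ)` with `α ≤ 1/p` and `0 ≤ β ≤ 1/d`. The first term is nonpositive; if `ρ ≤ c (1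
⊗ σ)`, the second is at most `c/d` by `trace_mul_inv_mul_le`.

Hence the squared average trace norm is at most `(p/d) c tr σ`. Limits reach singular states `σ` and
`c = 2^(-k)`, and the bound on `log |A₁|` says exactly that `(p/d) 2^(-k) ≤ ε²`. -/

namespace QCExtractor

/-! ### Weighted trace inequalities -/

section TraceInequalities

variable {m : Type*} [Fintype m] [DecidableEq m]

/-- With `P = |X|`, the trace of `(P - tτ) τ⁻¹ (P - tτ)` is a nonnegative quadratic in the real
variable `t`; its discriminant is therefore at most zero. -/
theorem traceNorm_sq_le (X τ : Matrix m m ℂ) (hτ : τ.PosDef) :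
    traceNorm X ^ 2 ≤ τ.trace.re * (X * τ⁻¹ * X.conjTranspose).trace.re := by
  set P : Matrix m m ℂ := CFC.sqrt (X.conjTranspose * X) with hP
  have hX : (0 : Matrix m m ℂ) ≤ X.conjTranspose * X :=
    (Matrix.posSemidef_conjTranspose_mul_self X).nonneg
  have hPP : P * P = X.conjTranspose * X := CFC.sqrt_mul_sqrt_self _ hX
  have hPH : P.conjTranspose = P :=
    (Matrix.nonneg_iff_posSemidef.mp (CFC.sqrt_nonneg (X.conjTranspose * X))).isHermitian
  have hu : IsUnit τ.det := (Matrix.isUnit_iff_isUnit_det τ).mp hτ.isUnit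
  have hinv : τ * τ⁻¹ = 1 := Matrix.mul_nonsing_inv τ hu
  have hinv' : τ⁻¹ * τ = 1 := Matrix.nonsing_inv_mul τ hu
  have htr : (X * τ⁻¹ * X.conjTranspose).trace = (P * τ⁻¹ * P).trace := by
    rw [Matrix.trace_mul_comm, ← Matrix.mul_assoc, ← hPP, Matrix.mul_assoc, Matrix.trace_mul_comm,
      Matrix.mul_assoc, ← Matrix.mul_assoc]
  have key : ∀ t : ℝ, 0 ≤ τ.trace.re * (t * t) + (-2 * P.trace.re) * t
      + (P * τ⁻¹ * P).trace.re := by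
    intro t
    have h := (hτ.inv.posSemidef.conjTranspose_mul_mul_same (P - (t : ℂ) • τ)).trace_nonneg
    have hH : (P - (t : ℂ) • τ).conjTranspose = P - (t : ℂ) • τ := by
      rw [Matrix.conjTranspose_sub, Matrix.conjTranspose_smul, hPH, hτ.isHermitian.eq]
      simp
    have he : (P - (t : ℂ) • τ) * τ⁻¹ * (P - (t : ℂ) • τ)
        = P * τ⁻¹ * P - (2 * (t : ℂ)) • P + ((t : ℂ) * t) • τ := by
      simp only [Matrix.sub_mul, Matrix.mul_sub, Matrix.smul_mul, Matrix.mul_smul, hinv,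
        Matrix.mul_assoc, hinv', Matrix.mul_one, Matrix.one_mul]
      module
    rw [hH, he] at h
    have h' := (Complex.le_def.mp h).1
    simp [Matrix.trace_add, Matrix.trace_sub, Matrix.trace_smul] at h'
    linarith
  have hd := discrim_le_zero key
  rw [discrim] at hd
  have hn : traceNorm X = P.trace.re := rfl
  rw [hn, htr]
  linarith

/-- Two positive traces are added: `ρ` conjugated by `c - τ⁻¹ρ`, and `cτ - ρ` conjugated by `τ⁻¹ρ`.
The terms of third order in `ρ` cancel, and division by `c` leaves the claim. -/
theorem trace_mul_inv_mul_le (ρ τ : Matrix m m ℂ) (hρ : ρ.PosSemidef) (hτ : τ.PosDef)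
    (c : ℝ) (hc : 0 < c) (h : ρ ≤ (c : ℂ) • τ) :
    (ρ * τ⁻¹ * ρ).trace.re ≤ c * ρ.trace.re := by
  have hu : IsUnit τ.det := (Matrix.isUnit_iff_isUnit_det τ).mp hτ.isUnit
  have hinv : τ * τ⁻¹ = 1 := Matrix.mul_nonsing_inv τ hu
  have hH : (τ⁻¹ * ρ).conjTranspose = ρ * τ⁻¹ := by
    rw [Matrix.conjTranspose_mul, hρ.isHermitian.eq, hτ.inv.isHermitian.eq]
  have h1 := (hρ.conjTranspose_mul_mul_same ((c : ℂ) • 1 - τ⁻¹ * ρ)).trace_nonneg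
  have h2 := ((Matrix.le_iff.mp h).conjTranspose_mul_mul_same (τ⁻¹ * ρ)).trace_nonneg
  have e1 : ((c : ℂ) • 1 - τ⁻¹ * ρ).conjTranspose * ρ * ((c : ℂ) • 1 - τ⁻¹ * ρ)
      = ((c : ℂ) * c) • ρ - (2 * c : ℂ) • (ρ * τ⁻¹ * ρ) + ρ * τ⁻¹ * ρ * τ⁻¹ * ρ := by
    rw [Matrix.conjTranspose_sub, hH, Matrix.conjTranspose_smul, Matrix.conjTranspose_one]
    simp only [Matrix.sub_mul, Matrix.mul_sub, Matrix.smul_mul, Matrix.mul_smul,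
      Matrix.mul_assoc, Matrix.mul_one, Matrix.one_mul, RCLike.star_def,
      Complex.conj_ofReal]
    module
  have e2 : (τ⁻¹ * ρ).conjTranspose * ((c : ℂ) • τ - ρ) * (τ⁻¹ * ρ)
      = (c : ℂ) • (ρ * τ⁻¹ * ρ) - ρ * τ⁻¹ * ρ * τ⁻¹ * ρ := by
    have hh : τ * (τ⁻¹ * ρ) = ρ := by rw [← Matrix.mul_assoc, hinv, Matrix.one_mul]
    rw [hH]
    simp only [Matrix.sub_mul, Matrix.mul_sub, Matrix.smul_mul, Matrix.mul_smul,
      Matrix.mul_assoc, hh]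
  rw [e1] at h1
  rw [e2] at h2
  have h1' := (Complex.le_def.mp h1).1
  have h2' := (Complex.le_def.mp h2).1
  simp [Matrix.trace_add, Matrix.trace_sub, Matrix.trace_smul] at h1' h2'
  have : 0 ≤ c * (c * ρ.trace.re - (ρ * τ⁻¹ * ρ).trace.re) := by nlinarith
  have := (mul_nonneg_iff_of_pos_left hc).mp this
  linarith

end TraceInequalities

/-! ### Operators commuting with all `W ⊗ W` -/

section Commutant

variable {A : Type*} [Fintype A] [DecidableEq A]

/-- If `N` commutes with every `W ⊗ W`, it has the entries of a combination of the identity and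
the swap operator. -/
theorem exists_entries_of_commute (N : Matrix (A × A) (A × A) ℂ)
    (hN : ∀ W ∈ Matrix.unitaryGroup A ℂ, (W ⊗ₖ W) * N = N * (W ⊗ₖ W)) :
    ∃ y z : ℂ, ∀ a b : A, N (a, b) (a, b) = y + (if a = b then z else 0) ∧
      N (a, b) (b, a) = z + (if a = b then y else 0) := by
  -- Test on the diagonal unitary with phase `i` at `c`. Having `c` zero, one or two times in a pair
  -- gives the distinct phases `1`, `i`, `-1`, so unequal counts force the entry to vanish; a phase
  -- `-1` would confuse zero with two.
  have hdiag : ∀ c u v u' v' : A,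
      ((if u = c then Complex.I else 1) * (if v = c then Complex.I else 1) -
        (if u' = c then Complex.I else 1) * (if v' = c then Complex.I else 1)) *
        N (u, v) (u', v') = 0 := by
    intro c u v u' v'
    have hW : Matrix.diagonal (fun u : A => if u = c then Complex.I else 1) ∈
        Matrix.unitaryGroup A ℂ := by
      rw [Matrix.mem_unitaryGroup_iff, Matrix.star_eq_conjTranspose,
        Matrix.diagonal_conjTranspose, Matrix.diagonal_mul_diagonal, ← Matrix.diagonal_one]
      congr 1
      funext u
      by_cases h : u = c <;> simp [h]
    have h := congrFun (congrFun (hN _ hW) (u, v)) (u', v')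
    rw [Matrix.diagonal_kronecker_diagonal, Matrix.diagonal_mul, Matrix.mul_diagonal] at h
    simp only at h
    linear_combination h
  have hI1 : Complex.I - 1 ≠ 0 := fun h => by simpa using congrArg Complex.im h
  have hI2 : 1 - Complex.I ≠ 0 := fun h => by simpa using congrArg Complex.im h
  have hI3 : (-1 : ℂ) - Complex.I ≠ 0 := fun h => by simpa using congrArg Complex.im h
  have hI4 : (-1 : ℂ) - 1 ≠ 0 := by norm_num
  have hI5 : Complex.I + 1 ≠ 0 := fun h => by simpa using congrArg Complex.im h
  have hperm : ∀ (π : Equiv.Perm A) (u v u' v' : A),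
      N (π u, π v) (π u', π v') = N (u, v) (u', v') := by
    intro π u v u' v'
    have hW : (Matrix.of fun i j : A => if i = π j then (1 : ℂ) else 0) ∈
        Matrix.unitaryGroup A ℂ := by
      rw [Matrix.mem_unitaryGroup_iff']
      ext i j
      simp [Matrix.mul_apply, Matrix.star_apply, Matrix.one_apply, eq_comm]
    have h := congrFun (congrFun (hN _ hW) (π u, π v)) (u', v')
    simp only [Matrix.mul_apply, Fintype.sum_prod_type, Matrix.kroneckerMap_apply,
      Matrix.of_apply, EmbeddingLike.apply_eq_iff_eq] at h
    simpa [ite_and, Finset.sum_ite_eq] using h.symm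
  -- Compare the `(aa, ab)` entries for a `W` mixing `a` and `b`. The phase relations leave two
  -- terms on the left and one on the right, with common factor `W a a * W a b = -12/25`.
  have hrot : ∀ a b : A, a ≠ b → N (a, a) (a, a) = N (a, b) (a, b) + N (b, a) (a, b) := by
    intro a b hab
    obtain ⟨W, hW, haa, hab'⟩ : ∃ W ∈ Matrix.unitaryGroup A ℂ, W a a = 3 / 5 ∧ W a b = -4 / 5 := by
      let v : A → ℂ := fun u => (if u = a then 1 else 0) + (if u = b then 2 else 0)
      have hv : v ⬝ᵥ v = 5 := by
        simp [v, dotProduct, mul_add, add_mul, Finset.sum_add_distrib, hab, hab.symm]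
        norm_num
      -- The reflection in the hyperplane orthogonal to `v = e_a + 2 e_b`; `v ⬝ᵥ v = 5` keeps its
      -- entries rational.
      refine ⟨1 - (2 / 5 : ℂ) • Matrix.vecMulVec v v, ?_, ?_, ?_⟩
      · have hs : star (1 - (2 / 5 : ℂ) • Matrix.vecMulVec v v) =
            1 - (2 / 5 : ℂ) • Matrix.vecMulVec v v := by
          ext i j
          have hv' : ∀ u, star (v u) = v u := fun u => by
            simp only [v]; split_ifs <;> simp
          simp only [Matrix.star_apply, Matrix.sub_apply, Matrix.smul_apply,
            Matrix.vecMulVec_apply, star_sub, smul_eq_mul, star_mul', hv', Matrix.one_apply]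
          split_ifs <;> simp_all [mul_comm]
        rw [Matrix.mem_unitaryGroup_iff, hs]
        simp only [Matrix.sub_mul, Matrix.mul_sub, Matrix.smul_mul, Matrix.mul_smul,
          Matrix.mul_one, Matrix.one_mul, Matrix.vecMulVec_mul_vecMulVec, hv, smul_smul,
          Matrix.vecMulVec_smul]
        module
      · simp [v, Matrix.vecMulVec_apply, hab]; norm_num
      · simp [v, Matrix.vecMulVec_apply, hab, hab.symm]; norm_num
    have h := congrFun (congrFun (hN _ hW) (a, a)) (a, b)
    simp only [Matrix.mul_apply, Matrix.kroneckerMap_apply] at h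
    have hL : ∑ p : A × A, W a p.1 * W a p.2 * N p (a, b) =
        W a a * W a b * N (a, b) (a, b) + W a b * W a a * N (b, a) (a, b) := by
      rw [← Finset.sum_subset (Finset.subset_univ {(a, b), (b, a)}),
        Finset.sum_pair (by simp [hab])]
      rintro ⟨u, v⟩ - hp
      have ha := hdiag a u v a b
      have hb := hdiag b u v a b
      by_cases h1 : u = a <;> by_cases h2 : v = a <;> by_cases h3 : u = b <;>
        by_cases h4 : v = b <;> simp_all
    have hR : ∑ p : A × A, N (a, a) p * (W p.1 a * W p.2 b) =
        N (a, a) (a, a) * (W a a * W a b) := by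
      rw [← Finset.sum_subset (Finset.subset_univ {(a, a)}), Finset.sum_singleton]
      rintro ⟨u, v⟩ - hp
      have ha := hdiag a a a u v
      by_cases h1 : u = a <;> by_cases h2 : v = a <;> simp_all
    rw [hL, hR, haa, hab'] at h
    linear_combination (-25 / 12 : ℂ) * (-h)
  by_cases hex : ∃ a b : A, a ≠ b
  · obtain ⟨a₀, b₀, h₀⟩ := hex
    -- Permutations act doubly transitively, so one off-diagonal pair fixes both constants.
    have htrans : ∀ a b : A, a ≠ b → ∃ π : Equiv.Perm A, π a₀ = a ∧ π b₀ = b := by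
      intro a b hab
      have hne : Equiv.swap a₀ a b₀ ≠ a := fun h => h₀ <| by
        have := congrArg (Equiv.swap a₀ a) h
        simpa [eq_comm] using this
      refine ⟨Equiv.swap (Equiv.swap a₀ a b₀) b * Equiv.swap a₀ a, ?_, ?_⟩
      · simp [Equiv.swap_apply_of_ne_of_ne hne.symm hab]
      · simp
    have hoff : ∀ a b : A, a ≠ b → N (a, b) (a, b) = N (a₀, b₀) (a₀, b₀) ∧
        N (a, b) (b, a) = N (a₀, b₀) (b₀, a₀) := by
      intro a b hab
      obtain ⟨π, rfl, rfl⟩ := htrans a b hab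
      exact ⟨hperm π _ _ _ _, hperm π _ _ _ _⟩
    have hon : ∀ a : A, N (a, a) (a, a) = N (a₀, b₀) (a₀, b₀) + N (a₀, b₀) (b₀, a₀) := by
      intro a
      obtain ⟨b, hb⟩ : ∃ b, a ≠ b := by
        by_contra! h
        exact h₀ ((h a₀).symm.trans (h b₀))
      rw [hrot a b hb, (hoff a b hb).1, (hoff b a hb.symm).2]
    refine ⟨N (a₀, b₀) (a₀, b₀), N (a₀, b₀) (b₀, a₀), fun a b => ?_⟩
    by_cases hab : a = b
    · subst hab
      simp [hon, add_comm]
    · simpa [hab] using hoff a b hab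
  · push Not at hex
    rcases isEmpty_or_nonempty A with hA | ⟨⟨c⟩⟩
    · exact ⟨0, 0, fun a => hA.elim a⟩
    -- In dimension one identity and swap coincide, so only `y + z` is determined; `z = 0` is a
    -- choice.
    · refine ⟨N (c, c) (c, c), 0, fun a b => ?_⟩
      rw [hex a c, hex b c]
      simp

end Commutant

/-! ### Invariance of the 2-design average -/

section Haar

variable {A : Type*} [Fintype A] [DecidableEq A]

instance haarUnitary_isMulLeftInvariant : (haarUnitary A).IsMulLeftInvariant :=
  inferInstanceAs (MeasureTheory.Measure.haarMeasure ⊤).IsMulLeftInvariant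

instance haarUnitary_isHaarMeasure : (haarUnitary A).IsHaarMeasure :=
  inferInstanceAs (MeasureTheory.Measure.haarMeasure ⊤).IsHaarMeasure

/-- The design average equals the Haar average. Conjugating it by `W ⊗ W` translates the integration
variable by `W` on the left, which Haar measure ignores. -/
theorem kronecker_mul_comm_twirl {L : ℕ} {U : Fin L → Matrix.unitaryGroup A ℂ}
    (hU : IsTwoDesign U) (M : Matrix (A × A) (A × A) ℂ) (W : Matrix A A ℂ)
    (hW : W ∈ Matrix.unitaryGroup A ℂ) :
    (W ⊗ₖ W) * ((1 / (L : ℂ)) • ∑ i, ((U i : Matrix A A ℂ) ⊗ₖ (U i : Matrix A A ℂ)) * M *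
        ((U i : Matrix A A ℂ).conjTranspose ⊗ₖ (U i : Matrix A A ℂ).conjTranspose)) =
      ((1 / (L : ℂ)) • ∑ i, ((U i : Matrix A A ℂ) ⊗ₖ (U i : Matrix A A ℂ)) * M *
        ((U i : Matrix A A ℂ).conjTranspose ⊗ₖ (U i : Matrix A A ℂ).conjTranspose)) *
        (W ⊗ₖ W) := by
  have hT := hU M
  set T : Matrix (A × A) (A × A) ℂ := (1 / (L : ℂ)) • ∑ i,
    ((U i : Matrix A A ℂ) ⊗ₖ (U i : Matrix A A ℂ)) * M *
        ((U i : Matrix A A ℂ).conjTranspose ⊗ₖ (U i : Matrix A A ℂ).conjTranspose)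
  let f : Matrix.unitaryGroup A ℂ → Matrix (A × A) (A × A) ℂ := fun V =>
    ((V : Matrix A A ℂ) ⊗ₖ (V : Matrix A A ℂ)) * M *
        ((V : Matrix A A ℂ).conjTranspose ⊗ₖ (V : Matrix A A ℂ).conjTranspose)
  have hint : ∀ x y, MeasureTheory.Integrable (fun V => f V x y) (haarUnitary A) := by
    intro x y
    have hf : Continuous f := by
      have hk : ∀ g : Matrix.unitaryGroup A ℂ → Matrix A A ℂ, Continuous g →
          Continuous fun V => g V ⊗ₖ g V := by
        intro g hg
        refine continuous_matrix fun p q => ?_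
        simp only [Matrix.kroneckerMap_apply]
        exact (hg.matrix_elem _ _).mul (hg.matrix_elem _ _)
      exact ((hk _ continuous_subtype_val).mul continuous_const).mul
        (hk _ continuous_subtype_val.matrix_conjTranspose)
    exact (hf.matrix_elem x y).integrable_of_hasCompactSupport
      (HasCompactSupport.of_compactSpace _)
  have hWs : W.conjTranspose * W = 1 := Matrix.mem_unitaryGroup_iff'.mp hW
  have hconj : (W ⊗ₖ W) * T * (W.conjTranspose ⊗ₖ W.conjTranspose) = T := by
    ext x y
    have h1 : ((W ⊗ₖ W) * T * (W.conjTranspose ⊗ₖ W.conjTranspose)) x y =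
        ∫ V, ((W ⊗ₖ W) * f V * (W.conjTranspose ⊗ₖ W.conjTranspose)) x y ∂(haarUnitary A) := by
      simp only [Matrix.mul_apply (N := W.conjTranspose ⊗ₖ W.conjTranspose),
        Matrix.mul_apply (M := W ⊗ₖ W), Finset.sum_mul]
      rw [MeasureTheory.integral_finsetSum _ fun q _ =>
        MeasureTheory.integrable_finsetSum _ fun p _ => ((hint p q).const_mul _).mul_const _]
      refine Finset.sum_congr rfl fun q _ => ?_
      rw [MeasureTheory.integral_finsetSum _ fun p _ => ((hint p q).const_mul _).mul_const _]
      refine Finset.sum_congr rfl fun p _ => ?_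
      rw [MeasureTheory.integral_mul_const, MeasureTheory.integral_const_mul, hT p q]
    have h2 : ∀ V, (W ⊗ₖ W) * f V * (W.conjTranspose ⊗ₖ W.conjTranspose) =
        f ((⟨W, hW⟩ : Matrix.unitaryGroup A ℂ) * V) := fun V => by
      simp only [f, Matrix.UnitaryGroup.mul_val, Matrix.conjTranspose_mul,
        Matrix.mul_kronecker_mul, Matrix.mul_assoc]
    simp only [h1, hT x y, h2]
    exact MeasureTheory.integral_mul_left_eq_self (fun V => f V x y) _
  calc (W ⊗ₖ W) * T = (W ⊗ₖ W) * T * ((W.conjTranspose ⊗ₖ W.conjTranspose) * (W ⊗ₖ W)) := by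
        rw [← Matrix.mul_kronecker_mul, hWs, Matrix.one_kronecker_one, Matrix.mul_one]
    _ = T * (W ⊗ₖ W) := by rw [← Matrix.mul_assoc, hconj]

end Haar

/-! ### Second moments of the measurement outcomes -/

section Marginal

variable {A₁ A₂ : Type*} [Fintype A₂]

/-- The outcome weights `∑_{a₂} ⟨a₁ a₂| Z |a₁ a₂⟩` of the measurement of `A₁`. -/
def diagMarginal (Z : Matrix (A₁ × A₂) (A₁ × A₂) ℂ) (a₁ : A₁) : ℂ :=
  ∑ a₂, Z (a₁, a₂) (a₁, a₂)

theorem sum_diagMarginal [Fintype A₁] (Z : Matrix (A₁ × A₂) (A₁ × A₂) ℂ) :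
    ∑ a₁, diagMarginal Z a₁ = Z.trace := by
  simp [diagMarginal, Matrix.trace, Fintype.sum_prod_type]

theorem diagMarginal_conjTranspose (Z : Matrix (A₁ × A₂) (A₁ × A₂) ℂ) (a₁ : A₁) :
    diagMarginal Z.conjTranspose a₁ = star (diagMarginal Z a₁) := by
  simp [diagMarginal]

theorem measurementMap_apply [Fintype A₁] [DecidableEq A₁]
    (Z : Matrix (A₁ × A₂) (A₁ × A₂) ℂ) (a a' : A₁) :
    measurementMap Z a a' = if a = a' then diagMarginal Z a else 0 := by
  by_cases h : a = a'
  · subst h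
    simp [measurementMap, Matrix.sum_apply, Matrix.single_apply, diagMarginal]
  · simp only [measurementMap, Matrix.sum_apply, Matrix.smul_apply, Matrix.single_apply, h,
      if_false]
    refine Finset.sum_eq_zero fun x _ => Finset.sum_eq_zero fun y _ => ?_
    rw [if_neg (fun hh => h (hh.1.symm.trans hh.2)), smul_zero]

/-- The coefficients by which a unitary 2-design averages the collision weights. -/
theorem exists_average_diagMarginal_mul [Fintype A₁] [DecidableEq A₁]
    [DecidableEq A₂] [Nonempty A₁] [Nonempty A₂] {L : ℕ} (hL : L ≠ 0)
    {U : Fin L → Matrix.unitaryGroup (A₁ × A₂) ℂ} (hU : IsTwoDesign U) :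
    ∃ α β : ℝ, 0 ≤ β ∧ β * Fintype.card (A₁ × A₂) ≤ 1 ∧ α * Fintype.card A₁ ≤ 1 ∧
      ∀ X Y : Matrix (A₁ × A₂) (A₁ × A₂) ℂ,
        (1 / (L : ℂ)) * ∑ i, ∑ a₁,
          diagMarginal ((U i : Matrix _ _ ℂ) * X * (U i : Matrix _ _ ℂ).conjTranspose) a₁ *
          diagMarginal ((U i : Matrix _ _ ℂ) * Y * (U i : Matrix _ _ ℂ).conjTranspose) a₁ =
        α * (X.trace * Y.trace) + β * (X * Y).trace := by
  have hL' : (L : ℂ) ≠ 0 := Nat.cast_ne_zero.mpr hL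
  have hUs : ∀ i, (U i : Matrix (A₁ × A₂) (A₁ × A₂) ℂ).conjTranspose * U i = 1 := fun i =>
    Matrix.mem_unitaryGroup_iff'.mp (U i).2
  set p : ℕ := Fintype.card A₁ with hp
  set q : ℕ := Fintype.card A₂ with hq
  have hp1 : 1 ≤ p := Fintype.card_pos
  have hq1 : 1 ≤ q := Fintype.card_pos
  have hd : Fintype.card (A₁ × A₂) = p * q := Fintype.card_prod _ _
  -- Three contractions of the averaged `X ⊗ Y` (collision weight, full trace, trace against the
  -- swap) are all linear in the same `y` and `z`. The last two are unitarily invariant, hence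
  -- known.
  have main : ∀ X Y : Matrix (A₁ × A₂) (A₁ × A₂) ℂ, ∃ y z : ℂ,
      (1 / (L : ℂ)) * ∑ i, ∑ a₁,
          diagMarginal ((U i : Matrix _ _ ℂ) * X * (U i : Matrix _ _ ℂ).conjTranspose) a₁ *
          diagMarginal ((U i : Matrix _ _ ℂ) * Y * (U i : Matrix _ _ ℂ).conjTranspose) a₁ =
        p * q * (q * y + z) ∧
      X.trace * Y.trace = p * q * (p * q * y + z) ∧
      (X * Y).trace = p * q * (y + p * q * z) := by
    intro X Y
    set T : Matrix ((A₁ × A₂) × (A₁ × A₂)) ((A₁ × A₂) × (A₁ × A₂)) ℂ :=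
      (1 / (L : ℂ)) • ∑ i, ((U i : Matrix _ _ ℂ) ⊗ₖ (U i : Matrix _ _ ℂ)) * (X ⊗ₖ Y) *
        ((U i : Matrix _ _ ℂ).conjTranspose ⊗ₖ (U i : Matrix _ _ ℂ).conjTranspose) with hT
    obtain ⟨y, z, hyz⟩ := exists_entries_of_commute T
      (fun W hW => kronecker_mul_comm_twirl hU (X ⊗ₖ Y) W hW)
    have hTe : ∀ a b a' b', T (a, b) (a', b') = (1 / (L : ℂ)) * ∑ i,
        ((U i : Matrix (A₁ × A₂) (A₁ × A₂) ℂ) * X * (U i : Matrix (A₁ × A₂) (A₁ × A₂) ℂ).conjTranspose) a a' *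
        ((U i : Matrix (A₁ × A₂) (A₁ × A₂) ℂ) * Y * (U i : Matrix (A₁ × A₂) (A₁ × A₂) ℂ).conjTranspose) b b' := by
      intro a b a' b'
      simp only [hT, ← Matrix.mul_kronecker_mul, Matrix.smul_apply, Matrix.sum_apply,
        Matrix.kroneckerMap_apply, smul_eq_mul]
    have hconst : ∀ c : ℂ, (1 / (L : ℂ)) * ∑ _i : Fin L, c = c := by
      intro c
      rw [Finset.sum_const, Finset.card_univ, Fintype.card_fin, nsmul_eq_mul]
      field_simp
    refine ⟨y, z, ?_, ?_, ?_⟩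
    · calc _ = ∑ a₁ : A₁, ∑ a₂ : A₂, ∑ a₂' : A₂, T ((a₁, a₂), (a₁, a₂')) ((a₁, a₂), (a₁, a₂')) := by
            simp only [hTe, diagMarginal, Finset.sum_mul_sum, ← Finset.mul_sum]
            congr 1
            rw [Finset.sum_comm]
            refine Finset.sum_congr rfl fun a₁ _ => ?_
            rw [Finset.sum_comm]
            refine Finset.sum_congr rfl fun a₂ _ => ?_
            rw [Finset.sum_comm]
            simp only [Finset.mul_sum]
        _ = _ := by
            simp only [(hyz _ _).1, Prod.mk.injEq, true_and, Finset.sum_add_distrib,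
              Finset.sum_const, Finset.sum_ite_eq, Finset.mem_univ, if_true, Finset.card_univ,
              nsmul_eq_mul, ← hp, ← hq]
            ring
    · calc _ = ∑ a, ∑ b, T (a, b) (a, b) := by
            simp only [hTe, ← Finset.mul_sum]
            rw [← hconst (X.trace * Y.trace)]
            congr 1
            simp_rw [Finset.sum_comm (t := (Finset.univ : Finset (Fin L)))]
            refine Finset.sum_congr rfl fun i _ => ?_
            have hc : ∀ Z : Matrix (A₁ × A₂) (A₁ × A₂) ℂ,
                ((U i : Matrix _ _ ℂ) * Z * (U i : Matrix _ _ ℂ).conjTranspose).trace =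
                  Z.trace := by
              intro Z
              rw [Matrix.trace_mul_comm, ← Matrix.mul_assoc, hUs, Matrix.one_mul]
            rw [← hc X, ← hc Y]
            simp only [Matrix.trace, Matrix.diag_apply, Finset.sum_mul_sum]
        _ = _ := by
            simp only [(hyz _ _).1, Finset.sum_add_distrib,
              Finset.sum_const, Finset.sum_ite_eq, Finset.mem_univ, if_true, Finset.card_univ,
              nsmul_eq_mul, hd]
            push_cast
            ring
    · calc _ = ∑ a, ∑ b, T (a, b) (b, a) := by
            simp only [hTe, ← Finset.mul_sum]
            rw [← hconst (X * Y).trace]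
            congr 1
            simp_rw [Finset.sum_comm (t := (Finset.univ : Finset (Fin L)))]
            refine Finset.sum_congr rfl fun i _ => ?_
            have hc : (((U i : Matrix _ _ ℂ) * X * (U i : Matrix _ _ ℂ).conjTranspose) *
                ((U i : Matrix _ _ ℂ) * Y * (U i : Matrix _ _ ℂ).conjTranspose)).trace =
                  (X * Y).trace := by
              have : ((U i : Matrix (A₁ × A₂) (A₁ × A₂) ℂ) * X * (U i : Matrix (A₁ × A₂) (A₁ × A₂) ℂ).conjTranspose) *
                ((U i : Matrix (A₁ × A₂) (A₁ × A₂) ℂ) * Y * (U i : Matrix (A₁ × A₂) (A₁ × A₂) ℂ).conjTranspose) =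
                (U i : Matrix (A₁ × A₂) (A₁ × A₂) ℂ) * X * ((U i : Matrix (A₁ × A₂) (A₁ × A₂) ℂ).conjTranspose * U i) * Y *
                  (U i : Matrix (A₁ × A₂) (A₁ × A₂) ℂ).conjTranspose := by simp only [Matrix.mul_assoc]
              rw [this, hUs, Matrix.mul_one, Matrix.trace_mul_comm, ← Matrix.mul_assoc,
                ← Matrix.mul_assoc, hUs, Matrix.one_mul]
            rw [← hc]
            simp only [Matrix.trace, Matrix.diag_apply, Matrix.mul_apply (M := _ * X * _)]
        _ = _ := by
            simp only [(hyz _ _).2, Finset.sum_add_distrib,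
              Finset.sum_const, Finset.sum_ite_eq, Finset.mem_univ, if_true, Finset.card_univ,
              nsmul_eq_mul, hd]
            push_cast
            ring
  have hpR : (1 : ℝ) ≤ p := by exact_mod_cast hp1
  have hqR : (1 : ℝ) ≤ q := by exact_mod_cast hq1
  rw [hd]
  push_cast
  rcases eq_or_lt_of_le (Nat.mul_le_mul hp1 hq1) with h1 | h1
  · have hp' : p = 1 := Nat.eq_one_of_mul_eq_one_right h1.symm
    have hq' : q = 1 := Nat.eq_one_of_mul_eq_one_left h1.symm
    -- For `d = 1` the linear system is singular; any admissible solution serves.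
    refine ⟨1, 0, le_rfl, by simp, by simp [hp'], fun X Y => ?_⟩
    obtain ⟨y, z, h1, h2, -⟩ := main X Y
    rw [h1, h2]
    simp [hp', hq']
  · have hdR : (1 : ℝ) < (p : ℝ) * q := by exact_mod_cast h1
    set d : ℝ := (p : ℝ) * q with hdd
    have hpos : 0 < d ^ 2 - 1 := by nlinarith
    have hqd : (q : ℝ) ≤ d := by nlinarith
    -- Elimination of `y` and `z` from the three equations of `main`.
    refine ⟨(d * q - 1) / (d ^ 2 - 1), (d - q) / (d ^ 2 - 1),
      div_nonneg (by linarith) hpos.le, ?_, ?_, fun X Y => ?_⟩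
    · rw [div_mul_eq_mul_div, div_le_one hpos]
      nlinarith
    · rw [div_mul_eq_mul_div, div_le_one hpos]
      have : (d * q - 1) * p = d ^ 2 - p := by rw [hdd]; ring
      linarith
    · obtain ⟨y, z, h1, h2, h3⟩ := main X Y
      have hne : ((d ^ 2 - 1 : ℝ) : ℂ) ≠ 0 := Complex.ofReal_ne_zero.mpr hpos.ne'
      have hdc : (p : ℂ) * q = (d : ℂ) := by rw [hdd]; push_cast; rfl
      rw [h1, h2, h3, hdc]
      push_cast at hne ⊢
      field_simp
      ring

end Marginal

/-! ### Block decomposition over `E` -/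

section Blocks

variable {A E : Type*}

/-- The block `⟨e| ρ |e'⟩`, an operator on `A`. -/
def block (ρ : Matrix (A × E) (A × E) ℂ) (e e' : E) : Matrix A A ℂ :=
  Matrix.of fun a a' => ρ (a, e) (a', e')

theorem block_conjTranspose {ρ : Matrix (A × E) (A × E) ℂ} (hρ : ρ.IsHermitian) (e e' : E) :
    (block ρ e e').conjTranspose = block ρ e' e := by
  ext a a'
  simpa [block] using hρ.apply (a, e') (a', e)

variable [Fintype A]

theorem reduced_apply (ρ : Matrix (A × E) (A × E) ℂ) (e e' : E) :
    reduced ρ e e' = (block ρ e e').trace := rfl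

theorem conjLeft_apply [Fintype E] [DecidableEq E] (U : Matrix A A ℂ)
    (ρ : Matrix (A × E) (A × E) ℂ) (a a' : A) (e e' : E) :
    conjLeft U ρ (a, e) (a', e') = (U * block ρ e e' * U.conjTranspose) a a' := by
  simp [conjLeft, Matrix.mul_apply, Fintype.sum_prod_type, block, Matrix.one_apply,
    Matrix.conjTranspose_apply, Finset.sum_mul, apply_ite]

/-- Reduces the bipartite second moment to pairs of operators on `A`. The blocks are not Hermitian
in general, which is why the averaging formula must hold for arbitrary `X` and `Y`. -/
theorem trace_mul_one_kronecker_mul [DecidableEq A] [Fintype E]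
    (ρ : Matrix (A × E) (A × E) ℂ) (G : Matrix E E ℂ) :
    (ρ * ((1 : Matrix A A ℂ) ⊗ₖ G) * ρ).trace =
      ∑ e, ∑ f, ∑ g, G f g * (block ρ e f * block ρ g e).trace := by
  have h : ∀ a a' e g, (ρ * ((1 : Matrix A A ℂ) ⊗ₖ G)) (a, e) (a', g) =
      ∑ f, ρ (a, e) (a', f) * G f g := by
    intro a a' e g
    simp [Matrix.mul_apply, Fintype.sum_prod_type, Matrix.one_apply, Finset.sum_ite_irrel]
  simp only [Matrix.trace, Matrix.diag_apply, Matrix.mul_apply (N := ρ), h, Fintype.sum_prod_type,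
    block, Matrix.of_apply, Matrix.mul_apply, Finset.sum_mul, Finset.mul_sum]
  simp_rw [Finset.sum_comm (s := (Finset.univ : Finset E)) (t := (Finset.univ : Finset A))]
  refine Finset.sum_congr rfl fun a _ => Finset.sum_congr rfl fun a' _ =>
    Finset.sum_congr rfl fun e _ => ?_
  rw [Finset.sum_comm]
  exact Finset.sum_congr rfl fun f _ => Finset.sum_congr rfl fun g _ => by ring

end Blocks

/-! ### The averaged deviation and its limits -/

section Extractor

variable {A₁ A₂ E : Type*} [Fintype A₁] [DecidableEq A₁] [Fintype A₂]
  [Fintype E] [DecidableEq E]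

/-- The deviation of the measured state from `1 / |A₁| ⊗ ρ_E`. -/
noncomputable def deviation (U : Matrix (A₁ × A₂) (A₁ × A₂) ℂ)
    (ρ : Matrix ((A₁ × A₂) × E) ((A₁ × A₂) × E) ℂ) : Matrix (A₁ × E) (A₁ × E) ℂ :=
  applyLeft measurementMap (conjLeft U ρ) -
    (((Fintype.card A₁ : ℂ)⁻¹) • (1 : Matrix A₁ A₁ ℂ)) ⊗ₖ reduced ρ

theorem block_deviation (U : Matrix (A₁ × A₂) (A₁ × A₂) ℂ)
    (ρ : Matrix ((A₁ × A₂) × E) ((A₁ × A₂) × E) ℂ) (e e' : E) :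
    block (deviation U ρ) e e' = Matrix.diagonal fun a =>
      diagMarginal (U * block ρ e e' * U.conjTranspose) a -
        (Fintype.card A₁ : ℂ)⁻¹ * (block ρ e e').trace := by
  ext a a'
  simp only [block, deviation, applyLeft, conjLeft_apply, Matrix.of_apply, Matrix.sub_apply,
    measurementMap_apply, Matrix.kroneckerMap_apply, Matrix.smul_apply, Matrix.one_apply,
    reduced_apply, Matrix.diagonal_apply, smul_eq_mul]
  split_ifs with h
  · rw [mul_one]; rfl
  · simp

theorem deviation_isHermitian (U : Matrix (A₁ × A₂) (A₁ × A₂) ℂ)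
    {ρ : Matrix ((A₁ × A₂) × E) ((A₁ × A₂) × E) ℂ} (hρ : ρ.IsHermitian) :
    (deviation U ρ).IsHermitian := by
  ext ⟨a, e⟩ ⟨a', e'⟩
  have h : (block (deviation U ρ) e' e).conjTranspose = block (deviation U ρ) e e' := by
    rw [block_deviation, block_deviation, Matrix.diagonal_conjTranspose]
    congr 1
    funext a
    rw [← block_conjTranspose hρ e' e, Matrix.trace_conjTranspose]
    simp only [Pi.star_apply, star_sub, star_mul', ← diagMarginal_conjTranspose,
      Matrix.conjTranspose_mul, Matrix.conjTranspose_conjTranspose, Matrix.mul_assoc]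
    simp
  exact congrFun (congrFun h a) a'

/-- Every block of the deviation is diagonal, and its outcome weights sum to a fixed trace.
Subtracting the uniform part therefore only shifts `α` by `1/|A₁|`. -/
theorem average_trace_deviation [DecidableEq A₂]
    [Nonempty A₁] [Nonempty A₂] {L : ℕ} (hL : L ≠ 0)
    {U : Fin L → Matrix.unitaryGroup (A₁ × A₂) ℂ} (hU : IsTwoDesign U) :
    ∃ α β : ℝ, 0 ≤ β ∧ β * Fintype.card (A₁ × A₂) ≤ 1 ∧ α * Fintype.card A₁ ≤ 1 ∧
      ∀ (ρ : Matrix ((A₁ × A₂) × E) ((A₁ × A₂) × E) ℂ) (G : Matrix E E ℂ),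
        (1 / (L : ℂ)) * ∑ i, (deviation (U i : Matrix _ _ ℂ) ρ * ((1 : Matrix A₁ A₁ ℂ) ⊗ₖ G) *
          deviation (U i : Matrix _ _ ℂ) ρ).trace =
        ((α - (Fintype.card A₁ : ℝ)⁻¹ : ℝ) : ℂ) * (reduced ρ * G * reduced ρ).trace +
          β * (ρ * ((1 : Matrix (A₁ × A₂) (A₁ × A₂) ℂ) ⊗ₖ G) * ρ).trace := by
  obtain ⟨α, β, h1, h2, h3, h⟩ := exists_average_diagMarginal_mul hL hU
  refine ⟨α, β, h1, h2, h3, fun ρ G => ?_⟩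
  have hL' : (L : ℂ) ≠ 0 := Nat.cast_ne_zero.mpr hL
  have hp : (Fintype.card A₁ : ℂ) ≠ 0 := Nat.cast_ne_zero.mpr Fintype.card_ne_zero
  have hdev : ∀ (V : Matrix.unitaryGroup (A₁ × A₂) ℂ) (e f g : E),
      (block (deviation (V : Matrix _ _ ℂ) ρ) e f *
        block (deviation (V : Matrix _ _ ℂ) ρ) g e).trace =
      ∑ a₁, diagMarginal ((V : Matrix _ _ ℂ) * block ρ e f * (V : Matrix _ _ ℂ).conjTranspose) a₁ *
          diagMarginal ((V : Matrix _ _ ℂ) * block ρ g e * (V : Matrix _ _ ℂ).conjTranspose) a₁ -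
        (Fintype.card A₁ : ℂ)⁻¹ * ((block ρ e f).trace * (block ρ g e).trace) := by
    intro V e f g
    have hc : ∀ Z : Matrix (A₁ × A₂) (A₁ × A₂) ℂ, ∑ a₁, diagMarginal
        ((V : Matrix _ _ ℂ) * Z * (V : Matrix _ _ ℂ).conjTranspose) a₁ = Z.trace := by
      intro Z
      have hV : (V : Matrix (A₁ × A₂) (A₁ × A₂) ℂ).conjTranspose * V = 1 :=
        Matrix.mem_unitaryGroup_iff'.mp V.2
      rw [sum_diagMarginal, Matrix.trace_mul_comm, ← Matrix.mul_assoc, hV, Matrix.one_mul]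
    rw [block_deviation, block_deviation, Matrix.diagonal_mul_diagonal, Matrix.trace_diagonal]
    simp only [sub_mul, mul_sub, Finset.sum_sub_distrib, ← Finset.mul_sum, ← Finset.sum_mul, hc,
      Finset.sum_const, Finset.card_univ, nsmul_eq_mul]
    field_simp
    ring
  have havg : ∀ e f g : E, (1 / (L : ℂ)) * ∑ i,
      (block (deviation (U i : Matrix _ _ ℂ) ρ) e f *
        block (deviation (U i : Matrix _ _ ℂ) ρ) g e).trace =
      ((α - (Fintype.card A₁ : ℝ)⁻¹ : ℝ) : ℂ) * ((block ρ e f).trace * (block ρ g e).trace) +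
        β * (block ρ e f * block ρ g e).trace := by
    intro e f g
    simp only [hdev, Finset.sum_sub_distrib, mul_sub, h, Finset.sum_const, Finset.card_univ,
      Fintype.card_fin, nsmul_eq_mul]
    push_cast
    field_simp
    ring
  have hred : (reduced ρ * G * reduced ρ).trace =
      ∑ e, ∑ f, ∑ g, G f g * ((block ρ e f).trace * (block ρ g e).trace) := by
    simp only [Matrix.trace, Matrix.diag_apply, Matrix.mul_apply, reduced_apply, Finset.sum_mul]
    refine Finset.sum_congr rfl fun e _ => ?_
    rw [Finset.sum_comm]
    refine Finset.sum_congr rfl fun f _ => Finset.sum_congr rfl fun g _ => ?_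
    rw [← Finset.sum_mul, ← Finset.sum_mul]
    simp only [← Finset.sum_mul]
    ring
  simp only [trace_mul_one_kronecker_mul, hred]
  -- Bring the average over `i` inside the sums over `E`, where `havg` evaluates it block by block.
  simp_rw [Finset.sum_comm (s := (Finset.univ : Finset (Fin L))), ← Finset.mul_sum]
  simp only [Finset.mul_sum _ _ (1 / (L : ℂ)), mul_left_comm (1 / (L : ℂ))]
  simp only [← Finset.mul_sum _ _ (1 / (L : ℂ)), havg]
  simp only [mul_add, Finset.sum_add_distrib, Finset.mul_sum, mul_left_comm]

/-- The extractor bound relative to a positive definite operator on `E`. -/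
theorem average_traceNorm_deviation_sq_le [DecidableEq A₂]
    [Nonempty A₁] [Nonempty A₂] {L : ℕ} (hL : L ≠ 0)
    {U : Fin L → Matrix.unitaryGroup (A₁ × A₂) ℂ} (hU : IsTwoDesign U)
    {ρ : Matrix ((A₁ × A₂) × E) ((A₁ × A₂) × E) ℂ} (hρ : IsState ρ)
    {σ : Matrix E E ℂ} (hσ : σ.PosDef) {c : ℝ} (hc : 0 < c)
    (h : ρ ≤ (c : ℂ) • ((1 : Matrix (A₁ × A₂) (A₁ × A₂) ℂ) ⊗ₖ σ)) :
    ((1 / (L : ℝ)) * ∑ i, traceNorm (deviation (U i : Matrix _ _ ℂ) ρ)) ^ 2 ≤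
      (Fintype.card A₁ / Fintype.card (A₁ × A₂) : ℝ) * c * σ.trace.re := by
  obtain ⟨α, β, hβ, hβd, hα, hav⟩ := average_trace_deviation (E := E) hL hU
  have hd : (0 : ℝ) < Fintype.card (A₁ × A₂) := Nat.cast_pos.mpr Fintype.card_pos
  have hp : (0 : ℝ) < Fintype.card A₁ := Nat.cast_pos.mpr Fintype.card_pos
  have hL' : (0 : ℝ) < L := Nat.cast_pos.mpr (Nat.pos_of_ne_zero hL)
  have hpt : ∀ i, traceNorm (deviation (U i : Matrix _ _ ℂ) ρ) ^ 2 ≤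
      (Fintype.card A₁ * σ.trace.re) * (deviation (U i : Matrix _ _ ℂ) ρ *
        ((1 : Matrix A₁ A₁ ℂ) ⊗ₖ σ⁻¹) * deviation (U i : Matrix _ _ ℂ) ρ).trace.re := by
    intro i
    have h1 := traceNorm_sq_le (deviation (U i : Matrix _ _ ℂ) ρ) ((1 : Matrix A₁ A₁ ℂ) ⊗ₖ σ)
      (Matrix.PosDef.one.kronecker hσ)
    rw [Matrix.inv_kronecker, inv_one, (deviation_isHermitian _ hρ.1.isHermitian).eq,
      Matrix.trace_kronecker, Matrix.trace_one] at h1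
    simpa using h1
  have hcs : ((1 / (L : ℝ)) * ∑ i, traceNorm (deviation (U i : Matrix _ _ ℂ) ρ)) ^ 2 ≤
      (1 / (L : ℝ)) * ∑ i, traceNorm (deviation (U i : Matrix _ _ ℂ) ρ) ^ 2 := by
    have := sq_sum_le_card_mul_sum_sq (s := (Finset.univ : Finset (Fin L)))
      (f := fun i => traceNorm (deviation (U i : Matrix _ _ ℂ) ρ))
    rw [Finset.card_univ, Fintype.card_fin] at this
    rw [mul_pow]
    calc _ ≤ (1 / (L : ℝ)) ^ 2 *
          (L * ∑ i, traceNorm (deviation (U i : Matrix _ _ ℂ) ρ) ^ 2) := by gcongr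
      _ = _ := by field_simp
  have hσ0 : 0 ≤ σ.trace.re := (Complex.le_def.mp hσ.posSemidef.trace_nonneg).1
  have hre := congrArg Complex.re (hav ρ σ⁻¹)
  have hsum : (1 / (L : ℝ)) * ∑ i, (deviation (U i : Matrix _ _ ℂ) ρ *
        ((1 : Matrix A₁ A₁ ℂ) ⊗ₖ σ⁻¹) * deviation (U i : Matrix _ _ ℂ) ρ).trace.re ≤
      c / Fintype.card (A₁ × A₂) := by
    have hq := trace_mul_inv_mul_le ρ _ hρ.1 (Matrix.PosDef.one.kronecker hσ) c hc h
    rw [Matrix.inv_kronecker, inv_one, hρ.2, Complex.one_re, mul_one] at hq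
    have hrH : (reduced ρ).conjTranspose = reduced ρ := by
      ext e e'
      rw [Matrix.conjTranspose_apply, reduced_apply, reduced_apply, ← Matrix.trace_conjTranspose,
        block_conjTranspose hρ.1.isHermitian]
    have hr : 0 ≤ (reduced ρ * σ⁻¹ * reduced ρ).trace.re := by
      have := (hσ.inv.posSemidef.conjTranspose_mul_mul_same (reduced ρ)).trace_nonneg
      rw [hrH] at this
      exact (Complex.le_def.mp this).1
    -- This sign allows the `ρ_E` term to be discarded.
    have hα' : α - (Fintype.card A₁ : ℝ)⁻¹ ≤ 0 := by
      rw [sub_nonpos, ← one_div, le_div_iff₀ hp]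
      exact hα
    have hβ' : β ≤ 1 / Fintype.card (A₁ × A₂) := (le_div_iff₀ hd).mpr hβd
    have hL2 : (1 / (L : ℂ)) = ((1 / (L : ℝ) : ℝ) : ℂ) := by push_cast; rfl
    rw [hL2, Complex.re_ofReal_mul, Complex.add_re, Complex.re_ofReal_mul, Complex.re_ofReal_mul,
      Complex.re_sum] at hre
    rw [hre]
    calc _ ≤ 0 + 1 / Fintype.card (A₁ × A₂) * c :=
          add_le_add (mul_nonpos_of_nonpos_of_nonneg hα' hr)
            ((mul_le_mul_of_nonneg_left hq hβ).trans (mul_le_mul_of_nonneg_right hβ' hc.le))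
      _ = _ := by ring
  calc _ ≤ (1 / (L : ℝ)) * ∑ i, traceNorm (deviation (U i : Matrix _ _ ℂ) ρ) ^ 2 := hcs
    _ ≤ (1 / (L : ℝ)) * ∑ i, (Fintype.card A₁ * σ.trace.re) * (deviation (U i : Matrix _ _ ℂ) ρ *
        ((1 : Matrix A₁ A₁ ℂ) ⊗ₖ σ⁻¹) * deviation (U i : Matrix _ _ ℂ) ρ).trace.re := by
      gcongr with i
      exact hpt i
    _ = (Fintype.card A₁ * σ.trace.re) * ((1 / (L : ℝ)) * ∑ i, (deviation (U i : Matrix _ _ ℂ) ρ *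
        ((1 : Matrix A₁ A₁ ℂ) ⊗ₖ σ⁻¹) * deviation (U i : Matrix _ _ ℂ) ρ).trace.re) := by
      rw [← Finset.mul_sum]; ring
    _ ≤ (Fintype.card A₁ * σ.trace.re) * (c / Fintype.card (A₁ × A₂)) := by gcongr
    _ = _ := by ring

/-- A singular `σ` is perturbed to `σ + δ 1`, which is invertible and still dominates; its trace `1
+ δ |E|` tends to `1`. -/
theorem average_traceNorm_deviation_sq_le_of_isState [DecidableEq A₂]
    [Nonempty A₁] [Nonempty A₂] {L : ℕ}
    (hL : L ≠ 0) {U : Fin L → Matrix.unitaryGroup (A₁ × A₂) ℂ} (hU : IsTwoDesign U)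
    {ρ : Matrix ((A₁ × A₂) × E) ((A₁ × A₂) × E) ℂ} (hρ : IsState ρ)
    {σ : Matrix E E ℂ} (hσ : IsState σ) {c : ℝ} (hc : 0 < c)
    (h : ρ ≤ (c : ℂ) • ((1 : Matrix (A₁ × A₂) (A₁ × A₂) ℂ) ⊗ₖ σ)) :
    ((1 / (L : ℝ)) * ∑ i, traceNorm (deviation (U i : Matrix _ _ ℂ) ρ)) ^ 2 ≤
      (Fintype.card A₁ / Fintype.card (A₁ × A₂) : ℝ) * c := by
  have hb : ∀ δ : ℝ, 0 < δ →
      ((1 / (L : ℝ)) * ∑ i, traceNorm (deviation (U i : Matrix _ _ ℂ) ρ)) ^ 2 ≤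
      (Fintype.card A₁ / Fintype.card (A₁ × A₂) : ℝ) * c * (1 + δ * Fintype.card E) := by
    intro δ hδ
    have hpd : ((δ : ℂ) • (1 : Matrix E E ℂ)).PosDef :=
      Matrix.PosDef.one.smul (Complex.zero_lt_real.mpr hδ)
    have hle : ρ ≤ (c : ℂ) • ((1 : Matrix (A₁ × A₂) (A₁ × A₂) ℂ) ⊗ₖ (σ + (δ : ℂ) • 1)) := by
      refine h.trans (Matrix.le_iff.mpr ?_)
      rw [← smul_sub, Matrix.kronecker_add, add_sub_cancel_left]
      exact (Matrix.PosSemidef.one.kronecker hpd.posSemidef).smul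
        (Complex.zero_le_real.mpr hc.le)
    have := average_traceNorm_deviation_sq_le hL hU hρ (Matrix.PosDef.posSemidef_add hσ.1 hpd)
      hc hle
    simpa [Matrix.trace_add, Matrix.trace_smul, hσ.2] using this
  have hlim : Filter.Tendsto (fun δ : ℝ =>
      (Fintype.card A₁ / Fintype.card (A₁ × A₂) : ℝ) * c * (1 + δ * Fintype.card E))
      (nhdsWithin 0 (Set.Ioi 0))
      (nhds ((Fintype.card A₁ / Fintype.card (A₁ × A₂) : ℝ) * c * (1 + 0 * Fintype.card E))) := by
    apply Filter.Tendsto.mono_left _ nhdsWithin_le_nhds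
    exact Continuous.tendsto (by fun_prop) 0
  have := ge_of_tendsto hlim (eventually_nhdsWithin_of_forall hb)
  simpa using this

theorem exists_isState_le_of_lt_condMinEntropy {A E : Type*} [Fintype A] [DecidableEq A]
    [Fintype E] {ρ : Matrix (A × E) (A × E) ℂ} {l : ℝ}
    (h : (l : EReal) < condMinEntropy ρ) :
    ∃ (σ : Matrix E E ℂ) (l' : ℝ), IsState σ ∧ l < l' ∧
      ρ ≤ (((2 : ℝ) ^ (-l') : ℝ) : ℂ) • ((1 : Matrix A A ℂ) ⊗ₖ σ) := by
  obtain ⟨_, ⟨σ, hσ, rfl⟩, hlt⟩ := lt_sSup_iff.mp h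
  obtain ⟨_, ⟨l', hl', rfl⟩, hlt'⟩ := lt_sSup_iff.mp hlt
  exact ⟨σ, l', hσ, EReal.coe_lt_coe_iff.mp hlt', hl'⟩

/-- Each `l < k` is beaten by an actual state and exponent, so letting `l` increase to `k` avoids
any attainment of the suprema. -/
theorem average_traceNorm_deviation_sq_le_two_rpow [DecidableEq A₂]
    [Nonempty A₁] [Nonempty A₂] {L : ℕ}
    (hL : L ≠ 0) {U : Fin L → Matrix.unitaryGroup (A₁ × A₂) ℂ} (hU : IsTwoDesign U)
    {ρ : Matrix ((A₁ × A₂) × E) ((A₁ × A₂) × E) ℂ} (hρ : IsState ρ) {k : ℝ}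
    (hk : (k : EReal) ≤ condMinEntropy ρ) :
    ((1 / (L : ℝ)) * ∑ i, traceNorm (deviation (U i : Matrix _ _ ℂ) ρ)) ^ 2 ≤
      (Fintype.card A₁ / Fintype.card (A₁ × A₂) : ℝ) * (2 : ℝ) ^ (-k) := by
  have hb : ∀ l : ℝ, l < k →
      ((1 / (L : ℝ)) * ∑ i, traceNorm (deviation (U i : Matrix _ _ ℂ) ρ)) ^ 2 ≤
      (Fintype.card A₁ / Fintype.card (A₁ × A₂) : ℝ) * (2 : ℝ) ^ (-l) := by
    intro l hl
    obtain ⟨σ, l', hσ, hll, hle⟩ := exists_isState_le_of_lt_condMinEntropy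
      ((EReal.coe_lt_coe_iff.mpr hl).trans_le hk)
    refine (average_traceNorm_deviation_sq_le_of_isState hL hU hρ hσ (by positivity) hle).trans ?_
    gcongr
    norm_num
  have hlim : Filter.Tendsto (fun l : ℝ =>
      (Fintype.card A₁ / Fintype.card (A₁ × A₂) : ℝ) * (2 : ℝ) ^ (-l))
      (nhdsWithin k (Set.Iio k))
      (nhds ((Fintype.card A₁ / Fintype.card (A₁ × A₂) : ℝ) * (2 : ℝ) ^ (-k))) := by
    apply Filter.Tendsto.mono_left _ nhdsWithin_le_nhds
    exact Continuous.tendsto (by fun_prop (disch := norm_num)) k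
  exact ge_of_tendsto hlim (eventually_nhdsWithin_of_forall hb)

end Extractor

end QCExtractor

theorem corollary1 {A₁ A₂ : Type*} [Fintype A₁] [DecidableEq A₁] [Nonempty A₁]
    [Fintype A₂] [DecidableEq A₂] [Nonempty A₂]
    (n : ℝ) (hn : n = Real.logb 2 (Fintype.card (A₁ × A₂)))
    (k : ℝ) (hk : k ∈ Set.Icc (-n) n) (ε : ℝ) (hε : 0 < ε)
    (hA₁ : Real.logb 2 (Fintype.card A₁) ≤ min n (n + k - 2 * Real.logb 2 (1 / ε)))
    {L : ℕ} (U : Fin L → Matrix.unitaryGroup (A₁ × A₂) ℂ)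
    (hU : QCExtractor.IsTwoDesign U) :
    QCExtractor.IsQCExtractor k ε U := by
  intro E _ _ ρ hρ hkρ
  rcases eq_or_ne L 0 with hL | hL
  -- The average over an empty family is `0`, since `1 / 0 = 0`.
  · subst hL
    simpa using hε.le
  have hsq := QCExtractor.average_traceNorm_deviation_sq_le_two_rpow hL hU hρ hkρ
  have hp : (0 : ℝ) < Fintype.card A₁ := Nat.cast_pos.mpr Fintype.card_pos
  have hd : (0 : ℝ) < Fintype.card (A₁ × A₂) := Nat.cast_pos.mpr Fintype.card_pos
  -- The size hypothesis in multiplicative form: `|A₁| ≤ |A| 2^k ε²`.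
  have hlog : Real.logb 2 (Fintype.card A₁) ≤
      Real.logb 2 (Fintype.card (A₁ × A₂) * 2 ^ k * ε ^ 2) := by
    rw [Real.logb_mul (by positivity) (by positivity), Real.logb_mul (by positivity) (by positivity),
      Real.logb_rpow (by norm_num) (by norm_num), ← hn, Real.logb_pow]
    have := hA₁.trans (min_le_right _ _)
    rw [one_div, Real.logb_inv] at this
    push_cast
    linarith
  have hle := (Real.logb_le_logb (by norm_num) hp (by positivity)).mp hlog
  refine abs_le_of_sq_le_sq' (hsq.trans ?_) hε.le |>.2
  rw [Real.rpow_neg (by norm_num), div_mul_eq_mul_div, div_le_iff₀ hd, ← div_eq_mul_inv,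
    div_le_iff₀ (by positivity)]
  linarith
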